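/- Let $u\cdot v=u^0v^0-u^1v^1-u^2v^2-u^3v^3$ on $\mathbb C^4$, $q^2=q\cdot q$, and $\lambda_K(a,b,c)=a^2+b^2+c^2-2ab-2ac-2bc$. Let $L\ge 1$ and let $p_1,p_2,p_3,p_4\in\mathbb C^4$ be external momenta with $p_1+p_2+p_3+p_4=0$, off-shell ($p_i^2\ne 0$ for $i=1,\dots,4$), with non-vanishing Gram determinant $\det(p_i\cdot p_j)_{i,j\le 3}\neq 0$. Put $s=(p_1+p_2)^2$, $t=(p_2+p_3)^2$ and assume $s\ne0$, $t\ne 0$ and $\lambda_K\!\left(1,\frac{p_1^2p_3^2}{st},\frac{p_2^2p_4^2}{st}\right)\neq0$. Consider the integrand of the four-dimensional $L$-loop planar ladder box with massless propagators, $$\omega_L=\frac{d^4\ell_1\wedge\dots\wedge d^4\ell_L}{(\ell_L+p_2+p_3)^2\prod_{i=1}^{L}(\ell_i-p_1)^2(\ell_i+p_2)^2(\ell_{i-1}-\ell_i)^2},\qquad \ell_0=0 .$$ A leading singularity of $\omega_L$ is an iterated maximal Leray residue of $\omega_L$ taken loop by loop, in the order $\ell_1,\dots,\ell_L$ and with complex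 loop momenta: at fixed later loop momenta, the residue in $\ell_i$ is taken on the polar sets $(\ell_i-p_1)^2=(\ell_i+p_2)^2=(\ell_i-\ell_{i+1})^2=0$ (where $\ell_{L+1}=-p_2-p_3$), where these cross normally, and then at a simple pole, at finite $\ell_i$, of the one-form that is left on the curve which they cut out; a holomorphic branch of the result is the integrand for the remaining loop momenta. Then $\omega_L$ has exactly two leading singularities, which differ only in sign, namely $$\pm\left(\frac{\imath}{4}\right)^{L}\;\frac{1}{s^{L}\,t\,\sqrt{\lambda_K\!\left(1,\frac{p_1^2p_3^2}{st},\frac{p_2^2p_4^2}{st}\right)}}\,.$$ Thus, up to the sign and the kinematics-independent factor $(\imath/4)^L$, the leading singularity equals $1/\big(s^Lt\sqrt{\lambda_K}\big)$. -/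

import Mathlib

open Filter Topology

noncomputable section

namespace Ladder

/-- Complexified momenta in four space-time dimensions. -/
abbrev Mom : Type := Fin 4 → ℂ

/-- The complex-bilinear extension of the Minkowski product, metric `diag (1, -1, -1, -1)`. -/
def mdot (u v : Mom) : ℂ := u 0 * v 0 - u 1 * v 1 - u 2 * v 2 - u 3 * v 3

/-- The Minkowski square `q²`. -/
def msq (q : Mom) : ℂ := mdot q q

/-- The Källén function. -/
def kallen (a b c : ℂ) : ℂ := a ^ 2 + b ^ 2 + c ^ 2 - 2 * a * b - 2 * a * c - 2 * b * c

/-- The Gram determinant `det (p_i · p_j)` of three momenta. -/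
def gram₃ (p₁ p₂ p₃ : Mom) : ℂ :=
  (Matrix.of fun i j : Fin 3 => mdot (![p₁, p₂, p₃] i) (![p₁, p₂, p₃] j)).det

/-! ### Leray residues of four-forms on the space of one loop momentum -/

/-- `(α₀ ∧ α₁ ∧ α₂ ∧ α₃) (v₀, v₁, v₂, v₃)` for four covectors on `ℂ⁴`. -/
def wedge₄ (α : Fin 4 → (Mom →L[ℂ] ℂ)) (v : Fin 4 → Mom) : ℂ :=
  (Matrix.of fun i j : Fin 4 => α i (v j)).det

/-- `(dℓ⁰ ∧ dℓ¹ ∧ dℓ² ∧ dℓ³) (v₀, v₁, v₂, v₃)`. -/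
def vol (v : Fin 4 → Mom) : ℂ := wedge₄ (fun i => ContinuousLinearMap.proj i) v

/-- The one-form `ψ` represents at the point `b` the composite Leray residue
`N d⁴ℓ / (dD₀ ∧ dD₁ ∧ dD₂)` of the four-form `f d⁴ℓ` on the polar sets `D₀ = D₁ = D₂ = 0`.
The polar sets cross normally at `b`, and near `b`, off the polar sets, the form `f d⁴ℓ` is
defined (the domain of `f` is `V`) and equals `N d⁴ℓ / (D₀ D₁ D₂)` with `N` holomorphic at `b`.
The value of `ψ` on vectors tangent to `D₀ = D₁ = D₂ = 0` is determined by these data. -/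
def IsTripleLerayResidue (V : Set Mom) (f : Mom → ℂ) (D : Fin 3 → Mom → ℂ) (b : Mom)
    (ψ : Mom →L[ℂ] ℂ) : Prop :=
  (∀ k, AnalyticAt ℂ (D k) b) ∧ (∀ k, D k b = 0) ∧
  LinearIndependent ℂ (fun k => fderiv ℂ (D k) b) ∧
  ∃ N : Mom → ℂ, AnalyticAt ℂ N b ∧
    (∀ᶠ l in 𝓝 b, (∀ k, D k l ≠ 0) → l ∈ V ∧ f l * ∏ k, D k l = N l) ∧
    ∀ v : Fin 4 → Mom,
      wedge₄ ![fderiv ℂ (D 0) b, fderiv ℂ (D 1) b, fderiv ℂ (D 2) b, ψ] v = N b * vol v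

/-- `r` is a maximal (four-fold) residue of the four-form `f d⁴ℓ` with domain `V`: the residue is
first taken on the three polar sets `D₀ = D₁ = D₂ = 0`, which leaves a one-form on the curve they
cut out, and then at a point `a` of that curve (smooth there, with local parameter `τ` and local
parametrization `γ`) at which this one-form has a simple pole. -/
def IsMaximalResidue (V : Set Mom) (f : Mom → ℂ) (D : Fin 3 → Mom → ℂ) (r : ℂ) : Prop :=
  ∃ (a : Mom) (γ : ℂ → Mom) (ψ : ℂ → (Mom →L[ℂ] ℂ)),
    (∀ k, AnalyticAt ℂ (D k) a) ∧ LinearIndependent ℂ (fun k => fderiv ℂ (D k) a) ∧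
    AnalyticAt ℂ γ 0 ∧ γ 0 = a ∧ deriv γ 0 ≠ 0 ∧ (∀ᶠ τ in 𝓝 (0 : ℂ), ∀ k, D k (γ τ) = 0) ∧
    (∀ᶠ τ in 𝓝[≠] (0 : ℂ), IsTripleLerayResidue V f D (γ τ) (ψ τ)) ∧
    Tendsto (fun τ => τ * ψ τ (deriv γ τ)) (𝓝[≠] 0) (𝓝 r) ∧ r ≠ 0

/-! ### Iterated residues, one loop momentum at a time -/

/-- `r` is an iterated maximal residue of the `4n`-form `f d⁴ℓ₁ ∧ ⋯ ∧ d⁴ℓₙ` with domain `V`.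
The momentum `ℓ₁` is treated first: at fixed `ℓ₂, …, ℓₙ`, a maximal residue is taken in `ℓ₁`
on the polar sets `cut (ℓ₂, …, ℓₙ)` and at a pole of the one-form that is left. A holomorphic
choice `g` (on an open set `W`) of such residues is the integrand for `ℓ₂, …, ℓₙ`, and one goes
on in the same way until no loop momentum is left. -/
def IsIteratedResidue (cut : ∀ n : ℕ, (Fin n → Mom) → Fin 3 → Mom → ℂ) :
    ∀ n : ℕ, Set (Fin n → Mom) → ((Fin n → Mom) → ℂ) → ℂ → Prop
  | 0, V, f, r => (Fin.elim0 : Fin 0 → Mom) ∈ V ∧ f (Fin.elim0 : Fin 0 → Mom) = r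
  | n + 1, V, f, r =>
      ∃ (W : Set (Fin n → Mom)) (g : (Fin n → Mom) → ℂ), IsOpen W ∧ AnalyticOnNhd ℂ g W ∧
        (∀ π ∈ W, IsMaximalResidue {l | (Fin.cons l π : Fin (n + 1) → Mom) ∈ V}
          (fun l => f (Fin.cons l π : Fin (n + 1) → Mom)) (cut n π) (g π)) ∧
        IsIteratedResidue cut n W g r

/-! ### The planar ladder box -/

/-- The chain `ℓ₀ = 0, ℓ₁, …, ℓ_L, ℓ_{L+1} = -(p₂ + p₃)`; consecutive differences are the momenta
in the rungs of the ladder. -/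
def chain (p₂ p₃ : Mom) {L : ℕ} (l : Fin L → Mom) : Fin (L + 2) → Mom :=
  Fin.cons (0 : Mom) (Fin.snoc l (-(p₂ + p₃)) : Fin (L + 1) → Mom)

/-- The product of the `3L + 1` massless propagators
`∏ᵢ (ℓᵢ - p₁)² (ℓᵢ + p₂)² (ℓᵢ₋₁ - ℓᵢ)² · (ℓ_L + p₂ + p₃)²` of the `L`-loop ladder box. -/
def ladderDenominator (p₁ p₂ p₃ : Mom) (L : ℕ) (l : Fin L → Mom) : ℂ :=
  (∏ i : Fin L, msq (l i - p₁) * msq (l i + p₂)) *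
    ∏ i : Fin (L + 1), msq (chain p₂ p₃ l i.castSucc - chain p₂ p₃ l i.succ)

/-- The propagators in which a loop momentum `ℓ` meets the external legs and the next loop:
`(ℓ - p₁)²`, `(ℓ + p₂)²`, `(ℓ - ℓ')²`, where `ℓ'` is the first of the later loop momenta `π`,
and `ℓ' = -(p₂ + p₃)` if there is none. -/
def ladderCut (p₁ p₂ p₃ : Mom) (n : ℕ) (π : Fin n → Mom) : Fin 3 → Mom → ℂ :=
  ![fun l => msq (l - p₁), fun l => msq (l + p₂),
    fun l => msq (l - (Fin.snoc π (-(p₂ + p₃)) : Fin (n + 1) → Mom) 0)]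

/-- `r` is a leading singularity of the four-dimensional `L`-loop ladder box: a maximal residue,
taken loop by loop, of the form `d⁴ℓ₁ ∧ ⋯ ∧ d⁴ℓ_L / (product of all propagators)`. -/
def IsLeadingSingularity (p₁ p₂ p₃ : Mom) (L : ℕ) (r : ℂ) : Prop :=
  IsIteratedResidue (ladderCut p₁ p₂ p₃) L {l | ladderDenominator p₁ p₂ p₃ L l ≠ 0}
    (fun l => 1 / ladderDenominator p₁ p₂ p₃ L l) r

end Ladder

end

/-!
The residue of `d⁴ℓ` on the four-fold cut `D₀ = D₁ = D₂ = ℓ² = 0` of one box is the inverse of the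
Jacobian of the four propagators. The Jacobian is a determinant of four momenta, and its square is a
Gram determinant, because the metric has determinant `-1`; on the cut this Gram determinant
is the Källén function `λ` of the box up to a constant (`det₄_sq_of_cut`). So one box gives
`± i / (4 √λ)`.

The next loop momentum `x` enters `λ = λ_K (p₁² (x + p₂)², p₂² (x - p₁)², (p₁ + p₂)² x²)`, and on
the polar sets `(x - p₁)² = (x + p₂)² = 0` of the next residue `λ` is the square of `s x²` with
`s = (p₁ + p₂)²` (`boxKallen_of_cut`). Hence, there, the residue is `± i / (4 s x²)`:
it recreates the propagator `x²` to the left of the next loop, and the argument repeats. In the last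
loop `x = -(p₂ + p₃)` gives `λ = s² t² λ_K (1, …)`.

That there are no other values is proved with squares throughout, which makes the choice of branches
irrelevant: `sq_of_isMaximalResidue` shows that a simple pole of the one-form on the cut curve
can only be a transversal zero of `ℓ²`, whatever branch of the integrand is used, and computes the
square of the residue there; `sq_of_isIteratedResidue` is the induction.

That both values occur is proved with an explicit branch of `√λ` (`rootKallen`), equal to `s x²` on
the polar sets. The four-fold cut has two points, distinguished by the sign of the Jacobian
(`exists_cut_point`), and the curve through each comes from the inverse function theorem
(`exists_cut_curve`). As `p₁², p₂², s ≠ 0`, the Gram determinant of `p₁, p₂, ℓ` does not vanish at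
these points (`gram₃_of_cut`), so that the nearby loop momenta are in general position for the
following step. The sign is free at the last step (`isIteratedResidue_of_hasLadderCut`).
-/

noncomputable section

namespace Ladder

/-! ### The Minkowski product and its gradients -/

lemma mdot_comm (u v : Mom) : mdot u v = mdot v u := by
  simp [mdot]; ring

lemma msq_sub (u v : Mom) : msq (u - v) = msq u - 2 * mdot u v + msq v := by
  simp [msq, mdot]; ring

lemma msq_add (u v : Mom) : msq (u + v) = msq u + 2 * mdot u v + msq v := by
  simp [msq, mdot]; ring

/-- The covector `v ↦ 2 y · v`, which is the differential of `q ↦ q²` at `y`. -/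
def gradMsq (y : Mom) : Mom →L[ℂ] ℂ :=
  LinearMap.toContinuousLinearMap
    { toFun := fun v => 2 * mdot y v
      map_add' := fun u v => by simp [mdot]; ring
      map_smul' := fun c v => by simp [mdot]; ring }

@[simp] lemma gradMsq_apply (y v : Mom) : gradMsq y v = 2 * mdot y v := rfl

lemma contDiff_msq {n : WithTop ℕ∞} : ContDiff ℂ n msq := by
  unfold msq mdot
  fun_prop

lemma continuous_msq : Continuous msq := (contDiff_msq (n := 0)).continuous

lemma hasStrictFDerivAt_msq (x b : Mom) :
    HasStrictFDerivAt (fun l => msq (l - x)) (gradMsq (b - x)) b := by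
  have h1 : HasStrictFDerivAt (fun l => msq (l - x)) (fderiv ℂ (fun l => msq (l - x)) b) b :=
    ((contDiff_msq (n := 1)).comp (contDiff_id.sub contDiff_const)).contDiffAt.hasStrictFDerivAt
      one_ne_zero
  convert h1 using 1
  have h2 : ∀ i : Fin 4, HasFDerivAt (fun l : Mom => (l - x) i)
      (ContinuousLinearMap.proj (R := ℂ) (φ := fun _ : Fin 4 => ℂ) i) b := fun i => by
    have := (hasFDerivAt_apply (𝕜 := ℂ) i b).sub_const (x i)
    exact this
  have h3 := ((((h2 0).mul (h2 0)).sub ((h2 1).mul (h2 1))).sub ((h2 2).mul (h2 2))).sub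
    ((h2 3).mul (h2 3))
  have h4 : HasFDerivAt (fun l => msq (l - x)) _ b := h3
  rw [h4.fderiv]
  ext v
  simp [mdot]
  ring

lemma hasFDerivAt_msq (b : Mom) : HasFDerivAt msq (gradMsq b) b := by
  simpa using (hasStrictFDerivAt_msq 0 b).hasFDerivAt

lemma analyticAt_msq_sub (x b : Mom) : AnalyticAt ℂ (fun l => msq (l - x)) b :=
  ((contDiff_msq (n := ⊤)).comp (contDiff_id.sub contDiff_const)).contDiffAt.analyticAt

/-! ### Wedge products of four covectors -/

/-- The matrix whose rows are the coordinates of four covectors. -/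
def coeff (α : Fin 4 → (Mom →L[ℂ] ℂ)) : Matrix (Fin 4) (Fin 4) ℂ :=
  Matrix.of fun i j => α i (Pi.single j 1)

lemma apply_eq_sum_coord (α : Mom →L[ℂ] ℂ) (v : Mom) :
    α v = ∑ j, α (Pi.single j 1) * v j := by
  conv_lhs => rw [pi_eq_sum_univ' v]
  simp only [map_sum, map_smul, smul_eq_mul, mul_comm]

lemma coeff_mulVec (α : Fin 4 → (Mom →L[ℂ] ℂ)) (v : Mom) (i : Fin 4) :
    (coeff α).mulVec v i = α i v := by
  rw [apply_eq_sum_coord]; rfl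

lemma wedge₄_eq_det_mul_vol (α : Fin 4 → (Mom →L[ℂ] ℂ)) (v : Fin 4 → Mom) :
    wedge₄ α v = (coeff α).det * vol v := by
  unfold vol wedge₄
  rw [← Matrix.det_mul]
  congr 1
  ext i j
  simp only [Matrix.of_apply, Matrix.mul_apply, apply_eq_sum_coord (α i) (v j)]
  rfl

lemma vol_single : vol (fun j => Pi.single j 1) = 1 := by
  unfold vol wedge₄
  rw [← Matrix.det_one (n := Fin 4) (R := ℂ)]
  congr 1
  ext i j
  simp [Matrix.one_apply, Pi.single_apply]

/-- The identity of four-forms in the definition of a composite residue is one scalar equation. -/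
lemma wedge₄_eq_mul_vol_iff (α : Fin 4 → (Mom →L[ℂ] ℂ)) (c : ℂ) :
    (∀ v, wedge₄ α v = c * vol v) ↔ (coeff α).det = c := by
  refine ⟨fun h => ?_, fun h v => by rw [wedge₄_eq_det_mul_vol, h]⟩
  simpa [wedge₄_eq_det_mul_vol, vol_single] using h (fun j => Pi.single j 1)

lemma linearIndependent_of_det_coeff_ne_zero {α : Fin 3 → (Mom →L[ℂ] ℂ)} {β : Mom →L[ℂ] ℂ}
    (h : (coeff ![α 0, α 1, α 2, β]).det ≠ 0) : LinearIndependent ℂ α := by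
  rw [Fintype.linearIndependent_iff]
  intro g hg
  have h1 : Matrix.vecMul ![g 0, g 1, g 2, 0] (coeff ![α 0, α 1, α 2, β]) = 0 := by
    ext j
    have := congrArg (fun χ : Mom →L[ℂ] ℂ => χ (Pi.single j 1)) hg
    simpa [Matrix.vecMul, dotProduct, Fin.sum_univ_succ, coeff] using this
  have h2 := Matrix.eq_zero_of_vecMul_eq_zero h h1
  intro i
  fin_cases i
  · simpa using congrFun h2 0
  · simpa using congrFun h2 1
  · simpa using congrFun h2 2

lemma surjective_of_linearIndependent {α : Fin 3 → (Mom →L[ℂ] ℂ)} (h : LinearIndependent ℂ α) :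
    Function.Surjective (fun (v : Mom) k => α k v) := by
  have hr : LinearIndependent ℂ
      (Matrix.of fun (k : Fin 3) (j : Fin 4) => α k (Pi.single j 1)).row := by
    rw [Fintype.linearIndependent_iff] at h ⊢
    intro g hg
    apply h
    ext v
    simp only [sum_apply, smul_apply, smul_eq_mul,
      zero_apply]
    simp_rw [apply_eq_sum_coord _ v, Finset.mul_sum]
    rw [Finset.sum_comm]
    refine Finset.sum_eq_zero fun j _ => ?_
    have := congrFun hg j
    simp only [Finset.sum_apply, Pi.smul_apply, Matrix.row_apply, Matrix.of_apply, smul_eq_mul,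
      Pi.zero_apply] at this
    simp_rw [← mul_assoc]
    rw [← Finset.sum_mul, this, zero_mul]
  have hs := LinearMap.range_eq_top.1 <| Submodule.eq_top_of_finrank_eq
    (show Module.finrank ℂ (LinearMap.range (Matrix.mulVecLin _)) = _ from
      hr.rank_matrix.trans (by simp))
  intro y
  obtain ⟨v, hv⟩ := hs y
  refine ⟨v, ?_⟩
  rw [← hv]
  ext k
  simp only [apply_eq_sum_coord (α k) v]
  rfl

/-- On a vector `u` killed by `α₀, α₁, α₂`, the values of covectors `β` and `δ` are in the ratio of
`α₀ ∧ α₁ ∧ α₂ ∧ β` to `α₀ ∧ α₁ ∧ α₂ ∧ δ`. -/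
lemma det_coeff_mul_apply {α : Fin 3 → (Mom →L[ℂ] ℂ)} (h : LinearIndependent ℂ α)
    {u : Mom} (hu : ∀ k, α k u = 0) (β δ : Mom →L[ℂ] ℂ) :
    (coeff ![α 0, α 1, α 2, β]).det * δ u = (coeff ![α 0, α 1, α 2, δ]).det * β u := by
  have hs := surjective_of_linearIndependent h
  choose e he using fun i : Fin 3 => hs (Pi.single i 1)
  have he' : ∀ i k, α k (e i) = (Pi.single i 1 : Fin 3 → ℂ) k := fun i k => congrFun (he i) k
  -- in the frame dual to the `αᵢ`, completed by `u`, the wedge product is triangular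
  have key : ∀ χ : Mom →L[ℂ] ℂ,
      χ u = (coeff ![α 0, α 1, α 2, χ]).det * vol ![e 0, e 1, e 2, u] := by
    intro χ
    rw [← wedge₄_eq_det_mul_vol]
    unfold wedge₄
    rw [Matrix.det_of_isLowerTriangular]
    · simp [Fin.prod_univ_succ, he']
    · intro i j hij
      have hij' : i < j := hij
      fin_cases i <;> fin_cases j <;> first | exact absurd hij' (by decide) | simp [he', hu]
  rw [key β, key δ]
  ring

lemma det_coeff_ne_zero {α : Fin 3 → (Mom →L[ℂ] ℂ)} (h : LinearIndependent ℂ α)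
    {u : Mom} (hu : ∀ k, α k u = 0) {δ : Mom →L[ℂ] ℂ} (hδ : δ u ≠ 0) :
    (coeff ![α 0, α 1, α 2, δ]).det ≠ 0 := by
  intro h0
  obtain ⟨c, hc, hc'⟩ := Matrix.exists_vecMul_eq_zero_iff.2 h0
  have hv : ∀ v : Mom, c 0 * α 0 v + c 1 * α 1 v + c 2 * α 2 v + c 3 * δ v = 0 := fun v => by
    have := Matrix.dotProduct_mulVec c (coeff ![α 0, α 1, α 2, δ]) v
    rw [hc', zero_dotProduct] at this
    simpa [dotProduct, coeff_mulVec, Fin.sum_univ_succ, add_assoc] using this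
  have h3 : c 3 = 0 := by simpa [hu, hδ] using hv u
  have hi := Fintype.linearIndependent_iff.1 h ![c 0, c 1, c 2] (by
    ext v
    simpa [h3, Fin.sum_univ_succ, add_assoc] using hv v)
  refine hc (funext fun i => ?_)
  fin_cases i
  exacts [hi 0, hi 1, hi 2, h3]

/-! ### Gram determinants and the four-mass box -/

/-- The determinant whose rows are the coordinates of four momenta. -/
def det₄ (u v x y : Mom) : ℂ := (Matrix.of ![u, v, x, y]).det

/-- The Källén function of the one-loop box with dual points `0, p₁, -p₂, x`. -/
def boxKallen (p₁ p₂ x : Mom) : ℂ :=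
  kallen (msq p₁ * msq (x + p₂)) (msq p₂ * msq (x - p₁)) (msq (p₁ + p₂) * msq x)

lemma det₄_expand (u v x y : Mom) : det₄ u v x y =
    u 0 * (v 1 * (x 2 * y 3 - x 3 * y 2) - v 2 * (x 1 * y 3 - x 3 * y 1) +
        v 3 * (x 1 * y 2 - x 2 * y 1))
      - u 1 * (v 0 * (x 2 * y 3 - x 3 * y 2) - v 2 * (x 0 * y 3 - x 3 * y 0) +
        v 3 * (x 0 * y 2 - x 2 * y 0))
      + u 2 * (v 0 * (x 1 * y 3 - x 3 * y 1) - v 1 * (x 0 * y 3 - x 3 * y 0) +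
        v 3 * (x 0 * y 1 - x 1 * y 0))
      - u 3 * (v 0 * (x 1 * y 2 - x 2 * y 1) - v 1 * (x 0 * y 2 - x 2 * y 0) +
        v 2 * (x 0 * y 1 - x 1 * y 0)) := by
  simp [det₄, Matrix.det_succ_row_zero, Fin.sum_univ_succ, Fin.succAbove]
  ring

lemma gram₃_expand (u v x : Mom) : gram₃ u v x =
    msq u * (msq v * msq x - mdot v x ^ 2) - mdot u v * (mdot u v * msq x - mdot v x * mdot u x)
      + mdot u x * (mdot u v * mdot v x - msq v * mdot u x) := by
  simp [gram₃, Matrix.det_fin_three, msq, mdot]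
  ring

/-- The Gram determinant of four momenta is minus the square of their determinant, since the metric
has determinant `-1`; the left side is the Gram determinant expanded in its last row and column. -/
lemma gram₄_eq_neg_det₄_sq (u v x y : Mom) :
    msq y * gram₃ u v x
      - (mdot u y ^ 2 * (msq v * msq x - mdot v x ^ 2)
        + mdot v y ^ 2 * (msq u * msq x - mdot u x ^ 2)
        + mdot x y ^ 2 * (msq u * msq v - mdot u v ^ 2)
        - 2 * mdot u y * mdot v y * (mdot u v * msq x - mdot v x * mdot u x)
        + 2 * mdot u y * mdot x y * (mdot u v * mdot v x - msq v * mdot u x)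
        - 2 * mdot v y * mdot x y * (msq u * mdot v x - mdot u v * mdot u x))
      = -det₄ u v x y ^ 2 := by
  rw [gram₃_expand, det₄_expand]
  simp only [msq, mdot]
  ring

/-- On the hyperplanes that replace the cut conditions once `q² = 0` is used, `q²` and the
determinant of the four gradients determine each other. -/
lemma det₄_sq_of_cut {p₁ p₂ x b : Mom} (h₁ : 2 * mdot p₁ b = msq p₁)
    (h₂ : 2 * mdot p₂ b = -msq p₂) (h₃ : 2 * mdot x b = msq x) :
    -det₄ p₁ p₂ x b ^ 2 = msq b * gram₃ p₁ p₂ x + boxKallen p₁ p₂ x / 16 := by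
  have e₁ : mdot p₁ b = msq p₁ / 2 := by linear_combination h₁ / 2
  have e₂ : mdot p₂ b = -msq p₂ / 2 := by linear_combination h₂ / 2
  have e₃ : mdot x b = msq x / 2 := by linear_combination h₃ / 2
  rw [← gram₄_eq_neg_det₄_sq, e₁, e₂, e₃, boxKallen, msq_add, msq_add, msq_sub,
    mdot_comm x p₂, mdot_comm x p₁,
    kallen]
  ring

/-- The differentials of `(q - p₁)²`, `(q + p₂)²`, `(q - x)²` at `b`. -/
def cutGrad (p₁ p₂ x b : Mom) : Fin 3 → (Mom →L[ℂ] ℂ) :=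
  ![gradMsq (b - p₁), gradMsq (b + p₂), gradMsq (b - x)]

lemma det_coeff_cutGrad (p₁ p₂ x b : Mom) :
    (coeff ![cutGrad p₁ p₂ x b 0, cutGrad p₁ p₂ x b 1, cutGrad p₁ p₂ x b 2, gradMsq b]).det =
      -16 * det₄ p₁ p₂ x b := by
  have h : coeff ![cutGrad p₁ p₂ x b 0, cutGrad p₁ p₂ x b 1, cutGrad p₁ p₂ x b 2, gradMsq b] =
      Matrix.of ![b - p₁, b + p₂, b - x, b] * Matrix.diagonal ![2, -2, -2, -2] := by
    ext i j
    rw [Matrix.mul_diagonal]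
    fin_cases i <;> fin_cases j <;> simp [coeff, cutGrad, mdot] <;> ring
  have h' : (Matrix.of ![b - p₁, b + p₂, b - x, b]).det = det₄ (b - p₁) (b + p₂) (b - x) b := rfl
  rw [h, Matrix.det_mul, Matrix.det_diagonal, h', det₄_expand, det₄_expand]
  simp [Fin.prod_univ_succ]
  ring

/-- The vector with `normal u v x · y = det (u, v, x, y)`, orthogonal to `u`, `v` and `x`. -/
def normal (u v x : Mom) : Mom := fun k =>
  ![1, -1, -1, -1] k * det₄ u v x (Pi.single k 1)

lemma det₄_normal (u v x : Mom) : det₄ u v x (normal u v x) = -gram₃ u v x := by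
  rw [det₄_expand, gram₃_expand]
  simp [normal, det₄_expand, msq, mdot]
  ring

/-- Momenta with prescribed products with `u`, `v`, `x` and prescribed determinant exist as soon as
the Gram determinant does not vanish. -/
lemma exists_mdot_eq {u v x : Mom} (h : gram₃ u v x ≠ 0) (c₁ c₂ c₃ c₄ : ℂ) :
    ∃ a, mdot u a = c₁ ∧ mdot v a = c₂ ∧ mdot x a = c₃ ∧ det₄ u v x a = c₄ := by
  set n := normal u v x with hn
  set M : Matrix (Fin 4) (Fin 4) ℂ :=
    Matrix.of ![u, v, x, n] * Matrix.diagonal ![1, -1, -1, -1] with hM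
  have hdet : M.det ≠ 0 := by
    have h' : (Matrix.of ![u, v, x, n]).det = det₄ u v x n := rfl
    rw [hM, Matrix.det_mul, Matrix.det_diagonal, h', hn, det₄_normal]
    simpa [Fin.prod_univ_succ] using h
  obtain ⟨a, ha⟩ := Matrix.mulVec_surjective_iff_isUnit.2
    ((Matrix.isUnit_iff_isUnit_det M).2 hdet.isUnit) ![c₁, c₂, c₃, c₄]
  have hr : ∀ i, M.mulVec a i = mdot (![u, v, x, n] i) a := fun i => by
    rw [Matrix.mulVec, dotProduct]
    simp only [hM, Matrix.mul_diagonal, Matrix.of_apply, mdot]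
    fin_cases i <;> simp [Fin.sum_univ_succ] <;> ring
  have hr' : ∀ i, mdot (![u, v, x, n] i) a = ![c₁, c₂, c₃, c₄] i := fun i => by rw [← hr, ha]
  refine ⟨a, hr' 0, hr' 1, hr' 2, ?_⟩
  have h3 : mdot n a = c₄ := hr' 3
  rw [← h3, det₄_expand]
  simp [hn, normal, det₄_expand, mdot]
  ring

/-- A solution of the four cut conditions with a prescribed choice of the square root of the
Källén function. -/
lemma exists_cut_point {p₁ p₂ x : Mom} (h : gram₃ p₁ p₂ x ≠ 0) {ω : ℂ}
    (hω : ω ^ 2 = boxKallen p₁ p₂ x) :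
    ∃ a, msq a = 0 ∧ msq (a - p₁) = 0 ∧ msq (a + p₂) = 0 ∧ msq (a - x) = 0 ∧
      det₄ p₁ p₂ x a = Complex.I * ω / 4 := by
  obtain ⟨a, h₁, h₂, h₃, h₄⟩ :=
    exists_mdot_eq h (msq p₁ / 2) (-msq p₂ / 2) (msq x / 2) (Complex.I * ω / 4)
  have h0 : msq a = 0 := by
    have := det₄_sq_of_cut (b := a) (by rw [h₁]; ring) (by rw [h₂]; ring) (by rw [h₃]; ring)
    have h5 : msq a * gram₃ p₁ p₂ x = 0 := by
      rw [h₄] at this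
      linear_combination -this + hω / 16 - ω ^ 2 / 16 * Complex.I_sq
    exact (mul_eq_zero.1 h5).resolve_right h
  refine ⟨a, h0, ?_, ?_, ?_, h₄⟩
  · rw [msq_sub, h0, mdot_comm, h₁]; ring
  · rw [msq_add, h0, mdot_comm, h₂]; ring
  · rw [msq_sub, h0, mdot_comm, h₃]; ring

lemma mdot_of_cut {p₁ p₂ x b : Mom} (h0 : msq b = 0) (h₁ : msq (b - p₁) = 0)
    (h₂ : msq (b + p₂) = 0) (h₃ : msq (b - x) = 0) :
    2 * mdot p₁ b = msq p₁ ∧ 2 * mdot p₂ b = -msq p₂ ∧ 2 * mdot x b = msq x := by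
  rw [msq_sub, h0, mdot_comm] at h₁ h₃
  rw [msq_add, h0, mdot_comm] at h₂
  refine ⟨?_, ?_, ?_⟩
  · linear_combination -h₁
  · linear_combination h₂
  · linear_combination -h₃

/-- On the four-fold cut the next loop momentum is again in general position relative to `p₁, p₂`;
this is where the external legs have to be off-shell. -/
lemma gram₃_of_cut {p₁ p₂ b : Mom} (h0 : msq b = 0) (h₁ : msq (b - p₁) = 0)
    (h₂ : msq (b + p₂) = 0) :
    gram₃ p₁ p₂ b = -(msq p₁ * msq p₂ * msq (p₁ + p₂)) / 4 := by
  obtain ⟨e₁, e₂, -⟩ := mdot_of_cut (x := 0) h0 h₁ h₂ (by simpa using h0)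
  have e₁' : mdot p₁ b = msq p₁ / 2 := by linear_combination e₁ / 2
  have e₂' : mdot p₂ b = -msq p₂ / 2 := by linear_combination e₂ / 2
  rw [gram₃_expand, e₁', e₂', h0, msq_add]
  ring

/-- On the polar sets of the external legs the Källén function is a perfect square, so that the
residue in one loop momentum recreates a propagator for the next one. -/
lemma boxKallen_of_cut {p₁ p₂ b : Mom} (h₁ : msq (b - p₁) = 0) (h₂ : msq (b + p₂) = 0) :
    boxKallen p₁ p₂ b = (msq (p₁ + p₂) * msq b) ^ 2 := by
  rw [boxKallen, h₁, h₂, kallen]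
  ring

/-! ### The residue in one loop momentum: its square is determined -/

/-- The three propagators cut in one loop momentum, `x` being the next loop momentum. -/
def cutFun (p₁ p₂ x : Mom) : Fin 3 → Mom → ℂ :=
  ![fun l => msq (l - p₁), fun l => msq (l + p₂), fun l => msq (l - x)]

lemma hasStrictFDerivAt_cutFun (p₁ p₂ x b : Mom) (k : Fin 3) :
    HasStrictFDerivAt (cutFun p₁ p₂ x k) (cutGrad p₁ p₂ x b k) b := by
  fin_cases k
  · exact hasStrictFDerivAt_msq p₁ b
  · simpa [cutFun, cutGrad] using hasStrictFDerivAt_msq (-p₂) b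
  · exact hasStrictFDerivAt_msq x b

lemma fderiv_cutFun (p₁ p₂ x b : Mom) (k : Fin 3) :
    fderiv ℂ (cutFun p₁ p₂ x k) b = cutGrad p₁ p₂ x b k :=
  (hasStrictFDerivAt_cutFun p₁ p₂ x b k).hasFDerivAt.fderiv

lemma analyticAt_cutFun (p₁ p₂ x b : Mom) (k : Fin 3) :
    AnalyticAt ℂ (cutFun p₁ p₂ x k) b := by
  fin_cases k
  · exact analyticAt_msq_sub p₁ b
  · simpa [cutFun] using analyticAt_msq_sub (-p₂) b
  · exact analyticAt_msq_sub x b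

lemma continuous_gradMsq_comp {X : Type*} [TopologicalSpace X] {y : X → Mom} (hy : Continuous y)
    (v : Mom) : Continuous fun t => gradMsq (y t) v := by
  simp only [gradMsq_apply, mdot]
  fun_prop

lemma continuous_det_coeff_cutGrad (p₁ p₂ x : Mom) (δ : Mom →L[ℂ] ℂ) :
    Continuous fun b => (coeff ![cutGrad p₁ p₂ x b 0, cutGrad p₁ p₂ x b 1,
      cutGrad p₁ p₂ x b 2, δ]).det := by
  refine Continuous.matrix_det ?_
  refine continuous_matrix fun i j => ?_
  fin_cases i
  · exact continuous_gradMsq_comp (y := fun b => b - p₁) (by fun_prop) _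
  · exact continuous_gradMsq_comp (y := fun b => b + p₂) (by fun_prop) _
  · exact continuous_gradMsq_comp (y := fun b => b - x) (by fun_prop) _
  · exact continuous_const (X := Mom) (y := δ (Pi.single j 1))

/-- Where three polar sets cross normally, an identity between continuous functions that holds off
the polar sets extends to the crossing point. -/
lemma eq_of_eventually_off_polar {D : Fin 3 → Mom → ℂ} {b : Mom}
    (hD : ∀ k, DifferentiableAt ℂ (D k) b)
    (hli : LinearIndependent ℂ fun k => fderiv ℂ (D k) b) {F : Mom → ℂ} {c : ℂ}
    (hF : ContinuousAt F b) (h : ∀ᶠ l in 𝓝 b, (∀ k, D k l ≠ 0) → F l = c) : F b = c := by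
  obtain ⟨v, hv⟩ := surjective_of_linearIndependent hli fun _ => 1
  -- leave all three polar sets along a transversal direction
  have hline : HasDerivAt (fun ε : ℂ => b + ε • v) v 0 := by
    simpa using ((hasDerivAt_id (0 : ℂ)).smul_const v).const_add b
  have hne : ∀ᶠ ε in 𝓝[≠] (0 : ℂ), ∀ k, D k (b + ε • v) ≠ 0 := by
    refine eventually_all.2 fun k => ?_
    have hk : HasFDerivAt (D k) (fderiv ℂ (D k) b) (b + (0 : ℂ) • v) := by
      simpa using (hD k).hasFDerivAt
    have := hk.comp_hasDerivAt (0 : ℂ) hline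
    refine this.eventually_ne ?_
    rw [show fderiv ℂ (D k) b v = 1 from congrFun hv k]
    exact one_ne_zero
  have hto : Tendsto (fun ε : ℂ => b + ε • v) (𝓝[≠] 0) (𝓝 b) := by
    have : Tendsto (fun ε : ℂ => b + ε • v) (𝓝 0) (𝓝 (b + (0 : ℂ) • v)) := hline.continuousAt
    rw [zero_smul, add_zero] at this
    exact this.mono_left nhdsWithin_le_nhds
  refine tendsto_nhds_unique (hF.tendsto.comp hto) (tendsto_const_nhds.congr' ?_)
  filter_upwards [hne, hto.eventually h] with ε h1 h2
  exact (h2 h1).symm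

/-- If the square of the integrand is `C / (Q (D₀ D₁ D₂)² R²)`, and `Q` is the square of
`(p₁ + p₂)² q²` on the polar sets of the external legs, then every maximal residue has the
square `-C / (16 (p₁ + p₂)⁴ R² λ)`, with the Källén function `λ` of the box. In particular the
one-form on the cut curve has simple poles only at transversal zeros of `q²`. -/
lemma sq_of_isMaximalResidue {p₁ p₂ x : Mom} {V : Set Mom} {f Q : Mom → ℂ} {R C r : ℂ}
    (hC : C ≠ 0) (hQ : Continuous Q)
    (hQ' : ∀ l, msq (l - p₁) = 0 → msq (l + p₂) = 0 → Q l = (msq (p₁ + p₂) * msq l) ^ 2)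
    (hV : ∀ l ∈ V, f l ^ 2 * Q l * ((∏ k, cutFun p₁ p₂ x k l) * R) ^ 2 = C)
    (h : IsMaximalResidue V f (cutFun p₁ p₂ x) r) :
    r ^ 2 * boxKallen p₁ p₂ x * R ^ 2 = C * (-1 / (16 * msq (p₁ + p₂) ^ 2)) := by
  obtain ⟨a, γ, ψ, -, hli, hγ, hγa, hγ', hcut, hres, hlim, hr⟩ := h
  set s := msq (p₁ + p₂) with hs
  have hcut_a : ∀ k, cutFun p₁ p₂ x k a = 0 := hγa ▸ hcut.self_of_nhds
  have hfd : ∀ b, (fun k => fderiv ℂ (cutFun p₁ p₂ x k) b) = cutGrad p₁ p₂ x b :=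
    fun b => funext fun k => fderiv_cutFun p₁ p₂ x b k
  rw [hfd] at hli
  -- the velocity of the curve is killed by the three differentials
  have htan : ∀ᶠ τ in 𝓝 (0 : ℂ), ∀ k, cutGrad p₁ p₂ x (γ τ) k (deriv γ τ) = 0 := by
    filter_upwards [hcut.eventually_nhds, hγ.eventually_analyticAt] with τ h1 h2 k
    have hd := (hasStrictFDerivAt_cutFun p₁ p₂ x (γ τ) k).hasFDerivAt.comp_hasDerivAt τ
      h2.differentiableAt.hasDerivAt
    have h0 : (cutFun p₁ p₂ x k ∘ γ) =ᶠ[𝓝 τ] fun _ => 0 := h1.mono fun σ hσ => hσ k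
    rw [← hd.deriv, h0.deriv_eq, deriv_const]
  have htan_a : ∀ k, cutGrad p₁ p₂ x a k (deriv γ 0) = 0 := hγa ▸ htan.self_of_nhds
  obtain ⟨j, hj⟩ : ∃ j, deriv γ 0 j ≠ 0 := by
    by_contra! hall
    exact hγ' (funext hall)
  set δ : Mom →L[ℂ] ℂ := ContinuousLinearMap.proj j with hδ
  set K : Mom → ℂ := fun b => (coeff ![cutGrad p₁ p₂ x b 0, cutGrad p₁ p₂ x b 1,
      cutGrad p₁ p₂ x b 2, δ]).det with hK
  have hKa : K a ≠ 0 := det_coeff_ne_zero hli htan_a hj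
  have hKc : Continuous K := continuous_det_coeff_cutGrad p₁ p₂ x δ
  -- the one-form on the curve, up to the sign lost in squaring
  have hform : ∀ᶠ τ in 𝓝[≠] (0 : ℂ),
      (τ * ψ τ (deriv γ τ)) ^ 2 * K (γ τ) ^ 2 * s ^ 2 * R ^ 2 * msq (γ τ) ^ 2 =
        C * τ ^ 2 * (deriv γ τ j) ^ 2 := by
    filter_upwards [hres, htan.filter_mono nhdsWithin_le_nhds] with τ h1 h2
    obtain ⟨-, hz, hl, N, hN, hNe, hw⟩ := h1
    have hN2 : N (γ τ) ^ 2 * Q (γ τ) * R ^ 2 = C := by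
      refine eq_of_eventually_off_polar (F := fun l => N l ^ 2 * Q l * R ^ 2)
        (fun k => (analyticAt_cutFun p₁ p₂ x _ k).differentiableAt) hl ?_ ?_
      · have := hN.continuousAt
        fun_prop
      · filter_upwards [hNe] with l hl' hne
        obtain ⟨hlV, hfN⟩ := hl' hne
        rw [← hV l hlV, ← hfN]
        ring
    rw [hQ' _ (hz 0) (hz 1)] at hN2
    rw [hfd] at hl
    simp only [fderiv_cutFun] at hw
    have hdet := (wedge₄_eq_mul_vol_iff _ _).1 hw
    have hrat := det_coeff_mul_apply hl h2 (ψ τ) δ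
    rw [hdet] at hrat
    have hrat' : N (γ τ) * deriv γ τ j = K (γ τ) * ψ τ (deriv γ τ) := hrat
    calc _ = τ ^ 2 * s ^ 2 * R ^ 2 * msq (γ τ) ^ 2 * (K (γ τ) * ψ τ (deriv γ τ)) ^ 2 := by ring
      _ = (N (γ τ) ^ 2 * (s * msq (γ τ)) ^ 2 * R ^ 2) * τ ^ 2 * (deriv γ τ j) ^ 2 := by
          rw [← hrat']; ring
      _ = _ := by rw [hN2]
  have hne : ∀ᶠ τ in 𝓝[≠] (0 : ℂ), τ ≠ 0 := eventually_mem_nhdsWithin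
  have hγc : Tendsto γ (𝓝[≠] 0) (𝓝 a) := hγa ▸ hγ.continuousAt.tendsto.mono_left nhdsWithin_le_nhds
  have hγ'c : Tendsto (fun τ => deriv γ τ j) (𝓝[≠] 0) (𝓝 (deriv γ 0 j)) :=
    (((continuous_apply j).continuousAt.comp hγ.deriv.continuousAt).tendsto).mono_left
      nhdsWithin_le_nhds
  have hKl : Tendsto (fun τ => K (γ τ)) (𝓝[≠] 0) (𝓝 (K a)) := (hKc.tendsto a).comp hγc
  have hpre : Tendsto (fun τ => (τ * ψ τ (deriv γ τ)) ^ 2 * K (γ τ) ^ 2 * s ^ 2 * R ^ 2)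
      (𝓝[≠] 0) (𝓝 (r ^ 2 * K a ^ 2 * s ^ 2 * R ^ 2)) :=
    (((hlim.pow 2).mul (hKl.pow 2)).mul_const _).mul_const _
  have hτ : Tendsto (fun τ : ℂ => τ) (𝓝[≠] 0) (𝓝 0) := tendsto_id.mono_left nhdsWithin_le_nhds
  have hsR : s ≠ 0 ∧ R ≠ 0 := by
    obtain ⟨τ, h1, h2, h3⟩ := (hform.and (hne.and (hγ'c.eventually_ne hj))).exists
    have : C * τ ^ 2 * deriv γ τ j ^ 2 ≠ 0 :=
      mul_ne_zero (mul_ne_zero hC (pow_ne_zero 2 h2)) (pow_ne_zero 2 h3)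
    rw [← h1] at this
    constructor
    · rintro h0
      simp [h0] at this
    · rintro h0
      simp [h0] at this
  have hP : r ^ 2 * K a ^ 2 * s ^ 2 * R ^ 2 ≠ 0 :=
    mul_ne_zero (mul_ne_zero (mul_ne_zero (pow_ne_zero 2 hr) (pow_ne_zero 2 hKa))
      (pow_ne_zero 2 hsR.1)) (pow_ne_zero 2 hsR.2)
  have hmsq : Tendsto (fun τ => msq (γ τ)) (𝓝[≠] 0) (𝓝 (msq a)) :=
    (continuous_msq.tendsto a).comp hγc
  -- the pole sits on `q² = 0`
  have ha0 : msq a = 0 := by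
    have h1 := hpre.mul (hmsq.pow 2)
    have h2 : Tendsto (fun τ => C * τ ^ 2 * (deriv γ τ j) ^ 2) (𝓝[≠] 0)
        (𝓝 (C * 0 ^ 2 * (deriv γ 0 j) ^ 2)) := ((hτ.pow 2).const_mul C).mul (hγ'c.pow 2)
    have h3 := tendsto_nhds_unique (h1.congr' hform) h2
    have h4 : (r ^ 2 * K a ^ 2 * s ^ 2 * R ^ 2) * msq a ^ 2 = 0 := by rw [h3]; ring
    exact pow_eq_zero_iff two_ne_zero |>.1 ((mul_eq_zero.1 h4).resolve_left hP)
  -- and `q²` vanishes there to first order along the curve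
  have hd : HasDerivAt (fun τ => msq (γ τ)) (gradMsq a (deriv γ 0)) 0 := by
    have h1 : HasFDerivAt msq (gradMsq a) (γ 0) := hγa ▸ hasFDerivAt_msq (γ 0)
    exact h1.comp_hasDerivAt (0 : ℂ) hγ.differentiableAt.hasDerivAt
  have hslope : Tendsto (fun τ : ℂ => τ⁻¹ * msq (γ τ)) (𝓝[≠] 0) (𝓝 (gradMsq a (deriv γ 0))) := by
    have := hd.tendsto_slope_zero
    simpa [hγa, ha0] using this
  have hval : (r ^ 2 * K a ^ 2 * s ^ 2 * R ^ 2) * gradMsq a (deriv γ 0) ^ 2 =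
      C * (deriv γ 0 j) ^ 2 := by
    refine tendsto_nhds_unique (hpre.mul (hslope.pow 2)) (((hγ'c.pow 2).const_mul C).congr' ?_)
    filter_upwards [hform, hne] with τ h1 h2
    linear_combination -τ⁻¹ ^ 2 * h1 -
      C * deriv γ τ j ^ 2 * (τ⁻¹ * τ + 1) * inv_mul_cancel₀ h2
  have hJ := det_coeff_mul_apply hli htan_a (gradMsq a) δ
  rw [det_coeff_cutGrad] at hJ
  have hJ' : -16 * det₄ p₁ p₂ x a * deriv γ 0 j = K a * gradMsq a (deriv γ 0) := hJ
  obtain ⟨e₁, e₂, e₃⟩ := mdot_of_cut ha0 (hcut_a 0) (hcut_a 1) (hcut_a 2)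
  have hdet := det₄_sq_of_cut e₁ e₂ e₃
  rw [ha0, zero_mul, zero_add] at hdet
  have hfin : (r ^ 2 * s ^ 2 * R ^ 2 * (256 * det₄ p₁ p₂ x a ^ 2) - C) * (deriv γ 0 j) ^ 2 = 0 := by
    linear_combination hval + r ^ 2 * s ^ 2 * R ^ 2 *
      (-16 * det₄ p₁ p₂ x a * deriv γ 0 j + K a * gradMsq a (deriv γ 0)) * hJ'
  have hfin' := (mul_eq_zero.1 hfin).resolve_right (pow_ne_zero 2 hj)
  have hs0 := hsR.1
  field_simp
  linear_combination -hfin' - 256 * r ^ 2 * s ^ 2 * R ^ 2 * hdet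

/-! ### The residue in one loop momentum: existence, with either sign -/

lemma contDiff_cutFun (p₁ p₂ x : Mom) (k : Fin 3) {n : WithTop ℕ∞} :
    ContDiff ℂ n (cutFun p₁ p₂ x k) := by
  fin_cases k
  · exact contDiff_msq.comp (contDiff_id.sub contDiff_const)
  · exact contDiff_msq.comp (contDiff_id.add contDiff_const)
  · exact contDiff_msq.comp (contDiff_id.sub contDiff_const)

lemma det_coeff_smul (α₀ α₁ α₂ β : Mom →L[ℂ] ℂ) (c : ℂ) :
    (coeff ![α₀, α₁, α₂, c • β]).det = c * (coeff ![α₀, α₁, α₂, β]).det := by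
  have h : coeff ![α₀, α₁, α₂, c • β] = (coeff ![α₀, α₁, α₂, β]).updateRow 3
      (c • coeff ![α₀, α₁, α₂, β] 3) := by
    ext i j
    fin_cases i <;> simp [coeff, Matrix.updateRow_apply]
  rw [h, Matrix.det_updateRow_smul, Matrix.updateRow_eq_self]

/-- The curve through a transversal point of the four-fold cut, parametrized by the value of the
uncut propagator `q²`. -/
lemma exists_cut_curve {p₁ p₂ x a : Mom} (h0 : msq a = 0) (hcut : ∀ k, cutFun p₁ p₂ x k a = 0)
    (hdet : det₄ p₁ p₂ x a ≠ 0) :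
    ∃ γ : ℂ → Mom, AnalyticAt ℂ γ 0 ∧ γ 0 = a ∧
      ∀ᶠ τ in 𝓝 (0 : ℂ), (∀ k, cutFun p₁ p₂ x k (γ τ) = 0) ∧ msq (γ τ) = τ := by
  set F : Mom → Mom := fun l =>
    ![cutFun p₁ p₂ x 0 l, cutFun p₁ p₂ x 1 l, cutFun p₁ p₂ x 2 l, msq l] with hF
  set α : Fin 4 → (Mom →L[ℂ] ℂ) :=
    ![cutGrad p₁ p₂ x a 0, cutGrad p₁ p₂ x a 1, cutGrad p₁ p₂ x a 2, gradMsq a] with hα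
  have hFa : F a = 0 := by
    ext i
    fin_cases i
    exacts [hcut 0, hcut 1, hcut 2, h0]
  have hFs : ContDiffAt ℂ ⊤ F a := by
    refine contDiffAt_pi.2 fun i => ?_
    fin_cases i
    exacts [(contDiff_cutFun p₁ p₂ x 0).contDiffAt, (contDiff_cutFun p₁ p₂ x 1).contDiffAt,
      (contDiff_cutFun p₁ p₂ x 2).contDiffAt, contDiff_msq.contDiffAt]
  have hF' : HasFDerivAt F (ContinuousLinearMap.pi α) a := by
    refine hasFDerivAt_pi.2 fun i => ?_
    fin_cases i
    exacts [(hasStrictFDerivAt_cutFun p₁ p₂ x a 0).hasFDerivAt,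
      (hasStrictFDerivAt_cutFun p₁ p₂ x a 1).hasFDerivAt,
      (hasStrictFDerivAt_cutFun p₁ p₂ x a 2).hasFDerivAt,
      hasFDerivAt_msq a]
  have hne : (ContinuousLinearMap.pi α).det ≠ 0 := by
    have h1 : ((ContinuousLinearMap.pi α : Mom →L[ℂ] Mom) : Mom →ₗ[ℂ] Mom) =
        Matrix.toLin' (coeff α) := by
      ext v i
      simp [coeff]
    rw [ContinuousLinearMap.det, h1, LinearMap.det_toLin', hα, det_coeff_cutGrad]
    exact mul_ne_zero (by norm_num) hdet
  set e := (ContinuousLinearMap.pi α).toContinuousLinearEquivOfDetNeZero hne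
  have hFe : HasFDerivAt F (e : Mom →L[ℂ] Mom) a := hF'
  have htop : (⊤ : WithTop ℕ∞) ≠ 0 := by simp
  set G := hFs.localInverse hFe htop with hG
  have hGa : G 0 = a := by rw [← hFa]; exact hFs.localInverse_apply_image hFe htop
  have hGs : ContDiffAt ℂ ⊤ G 0 := by rw [← hFa]; exact hFs.to_localInverse hFe htop
  have hGr : ∀ᶠ y in 𝓝 (0 : Mom), F (G y) = y := by
    have := (hFs.hasStrictFDerivAt' hFe htop).eventually_right_inverse
    rwa [hFa] at this
  have hline : ContDiff ℂ ⊤ fun τ : ℂ => τ • (Pi.single 3 1 : Mom) :=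
    contDiff_id.smul contDiff_const
  have hline0 : (0 : ℂ) • (Pi.single 3 1 : Mom) = 0 := zero_smul _ _
  refine ⟨fun τ => G (τ • Pi.single 3 1), ?_, ?_, ?_⟩
  · refine ContDiffAt.analyticAt ?_
    exact ContDiffAt.comp (0 : ℂ) (by rwa [hline0]) hline.contDiffAt
  · change G ((0 : ℂ) • (Pi.single 3 1 : Mom)) = a
    rw [hline0, hGa]
  · have ht : Tendsto (fun τ : ℂ => τ • (Pi.single 3 1 : Mom)) (𝓝 0) (𝓝 0) := by
      have := hline.continuous.tendsto 0
      rwa [hline0] at this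
    filter_upwards [ht.eventually hGr] with τ hτ
    refine ⟨fun k => ?_, ?_⟩
    · fin_cases k
      · simpa [hF] using congrFun hτ 0
      · simpa [hF] using congrFun hτ 1
      · simpa [hF] using congrFun hτ 2
    · simpa [hF] using congrFun hτ 3

lemma continuous_gram₃ (p₁ p₂ : Mom) : Continuous (gram₃ p₁ p₂) := by
  have : gram₃ p₁ p₂ = _ := funext fun x => gram₃_expand p₁ p₂ x
  rw [this]
  simp only [msq, mdot]
  fun_prop

lemma continuous_det₄ (p₁ p₂ x : Mom) : Continuous (det₄ p₁ p₂ x) := by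
  have : det₄ p₁ p₂ x = _ := funext fun y => det₄_expand p₁ p₂ x y
  rw [this]
  fun_prop

/-- If at the points of the cut curve in general position the integrand has the leading
coefficient `κ / ((p₁ + p₂)² q²)`, then `± i κ / (4 (p₁ + p₂)² √λ)` are maximal residues; the sign
of the root `ω` of the Källén function selects one of the two points of the four-fold cut. -/
lemma isMaximalResidue_of_cut {p₁ p₂ x : Mom} {V : Set Mom} {f : Mom → ℂ} {κ ω : ℂ}
    (hp₁ : msq p₁ ≠ 0) (hp₂ : msq p₂ ≠ 0) (hs : msq (p₁ + p₂) ≠ 0)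
    (hgram : gram₃ p₁ p₂ x ≠ 0) (hω : ω ^ 2 = boxKallen p₁ p₂ x) (hω0 : ω ≠ 0) (hκ : κ ≠ 0)
    (hV : ∀ b, msq b ≠ 0 → gram₃ p₁ p₂ b ≠ 0 → (∀ k, cutFun p₁ p₂ x k b = 0) →
      ∃ N : Mom → ℂ, AnalyticAt ℂ N b ∧ N b = κ / (msq (p₁ + p₂) * msq b) ∧
        ∀ᶠ l in 𝓝 b, (∀ k, cutFun p₁ p₂ x k l ≠ 0) →
          l ∈ V ∧ f l * ∏ k, cutFun p₁ p₂ x k l = N l) :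
    IsMaximalResidue V f (cutFun p₁ p₂ x) (κ * (Complex.I / (4 * msq (p₁ + p₂))) / ω) := by
  obtain ⟨a, h0, h₁, h₂, h₃, hdet⟩ := exists_cut_point hgram hω
  have hI := Complex.I_ne_zero
  have hcut_a : ∀ k, cutFun p₁ p₂ x k a = 0 := by
    intro k
    fin_cases k
    exacts [h₁, h₂, h₃]
  have hdet0 : det₄ p₁ p₂ x a ≠ 0 := by
    rw [hdet]
    exact div_ne_zero (mul_ne_zero hI hω0) (by norm_num)
  obtain ⟨γ, hγ, hγa, hγc⟩ := exists_cut_curve h0 hcut_a hdet0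
  have hli : ∀ b, det₄ p₁ p₂ x b ≠ 0 →
      LinearIndependent ℂ (fun k => fderiv ℂ (cutFun p₁ p₂ x k) b) := by
    intro b hb
    rw [show (fun k => fderiv ℂ (cutFun p₁ p₂ x k) b) = cutGrad p₁ p₂ x b from
      funext fun k => fderiv_cutFun p₁ p₂ x b k]
    refine linearIndependent_of_det_coeff_ne_zero (β := gradMsq b) ?_
    rw [det_coeff_cutGrad]
    exact mul_ne_zero (by norm_num) hb
  have hγt : Tendsto γ (𝓝 0) (𝓝 a) := hγa ▸ hγ.continuousAt.tendsto
  have hspeed : ∀ᶠ τ in 𝓝 (0 : ℂ), gradMsq (γ τ) (deriv γ τ) = 1 := by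
    filter_upwards [hγc.eventually_nhds, hγ.eventually_analyticAt] with τ h1 h2
    have hd := (hasFDerivAt_msq (γ τ)).comp_hasDerivAt τ h2.differentiableAt.hasDerivAt
    have h3 : (msq ∘ γ) =ᶠ[𝓝 τ] id := h1.mono fun σ hσ => hσ.2
    rw [← hd.deriv, h3.deriv_eq, deriv_id]
  have hgram_a : gram₃ p₁ p₂ a ≠ 0 := by
    rw [gram₃_of_cut h0 h₁ h₂]
    exact div_ne_zero (neg_ne_zero.2 (mul_ne_zero (mul_ne_zero hp₁ hp₂) hs)) (by norm_num)
  have hnear : ∀ᶠ τ in 𝓝 (0 : ℂ), gram₃ p₁ p₂ (γ τ) ≠ 0 ∧ det₄ p₁ p₂ x (γ τ) ≠ 0 :=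
    (((continuous_gram₃ p₁ p₂).tendsto a).comp hγt |>.eventually_ne hgram_a).and
      (((continuous_det₄ p₁ p₂ x).tendsto a).comp hγt |>.eventually_ne hdet0)
  have hne : ∀ᶠ τ in 𝓝[≠] (0 : ℂ), τ ≠ 0 := eventually_mem_nhdsWithin
  refine ⟨a, γ, fun τ => (κ / (msq (p₁ + p₂) * msq (γ τ)) / (-16 * det₄ p₁ p₂ x (γ τ))) •
    gradMsq (γ τ), fun k => analyticAt_cutFun p₁ p₂ x a k, hli a hdet0, hγ, hγa, ?_,
    hγc.mono fun τ h => h.1, ?_, ?_, ?_⟩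
  · intro h
    have := hspeed.self_of_nhds
    rw [h, map_zero] at this
    exact zero_ne_one this
  · filter_upwards [hne, hγc.filter_mono nhdsWithin_le_nhds,
      hnear.filter_mono nhdsWithin_le_nhds] with τ hτ h1 h2
    obtain ⟨N, hN, hNb, hNe⟩ := hV (γ τ) (by rwa [h1.2]) h2.1 h1.1
    refine ⟨fun k => analyticAt_cutFun p₁ p₂ x _ k, h1.1, hli _ h2.2, N, hN, hNe, ?_⟩
    rw [wedge₄_eq_mul_vol_iff]
    simp only [fderiv_cutFun]
    rw [det_coeff_smul, det_coeff_cutGrad, hNb]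
    exact div_mul_cancel₀ _ (mul_ne_zero (by norm_num) h2.2)
  · have hlim : Tendsto (fun τ => κ / msq (p₁ + p₂) / (-16 * det₄ p₁ p₂ x (γ τ))) (𝓝[≠] 0)
        (𝓝 (κ / msq (p₁ + p₂) / (-16 * det₄ p₁ p₂ x a))) :=
      (tendsto_const_nhds.div ((((continuous_det₄ p₁ p₂ x).tendsto a).comp hγt).const_mul _)
        (mul_ne_zero (by norm_num) hdet0)).mono_left nhdsWithin_le_nhds
    have hval : κ / msq (p₁ + p₂) / (-16 * det₄ p₁ p₂ x a) =
        κ * (Complex.I / (4 * msq (p₁ + p₂))) / ω := by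
      rw [hdet]
      field_simp
      linear_combination (-16 : ℂ) * Complex.I_sq
    rw [hval] at hlim
    refine hlim.congr' ?_
    filter_upwards [hne, hγc.filter_mono nhdsWithin_le_nhds,
      hspeed.filter_mono nhdsWithin_le_nhds, hnear.filter_mono nhdsWithin_le_nhds]
      with τ hτ h1 h2 h3
    have h4 := h3.2
    rw [smul_apply, h2, h1.2, smul_eq_mul]
    field_simp
  · exact div_ne_zero (mul_ne_zero hκ (div_ne_zero hI (mul_ne_zero (by norm_num) hs))) hω0

/-! ### Splitting off one loop momentum -/

/-- The first of the loop momenta `π`, and `-(p₂ + p₃)` if there is none. -/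
def firstMom (p₂ p₃ : Mom) {n : ℕ} (π : Fin n → Mom) : Mom :=
  (Fin.snoc π (-(p₂ + p₃)) : Fin (n + 1) → Mom) 0

/-- The product of all propagators of the ladder with loop momenta `l`, except the first rung `l₁²`:
this is the part of the integrand that splits off one loop momentum at a time. -/
def restDenominator (p₁ p₂ p₃ : Mom) (n : ℕ) (l : Fin n → Mom) : ℂ :=
  (∏ i : Fin n, msq (l i - p₁) * msq (l i + p₂)) *
    ∏ i : Fin n, msq ((Fin.snoc l (-(p₂ + p₃)) : Fin (n + 1) → Mom) i.castSucc -
      (Fin.snoc l (-(p₂ + p₃)) : Fin (n + 1) → Mom) i.succ)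

lemma firstMom_cons (p₂ p₃ : Mom) {n : ℕ} (l : Mom) (π : Fin n → Mom) :
    firstMom p₂ p₃ (Fin.cons l π : Fin (n + 1) → Mom) = l := by
  rw [firstMom, ← Fin.cons_snoc_eq_snoc_cons, Fin.cons_zero]

lemma firstMom_zero (p₂ p₃ : Mom) (π : Fin 0 → Mom) : firstMom p₂ p₃ π = -(p₂ + p₃) := by
  simp [firstMom, Fin.snoc]

lemma restDenominator_zero (p₁ p₂ p₃ : Mom) (l : Fin 0 → Mom) :
    restDenominator p₁ p₂ p₃ 0 l = 1 := by
  simp [restDenominator]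

lemma restDenominator_cons (p₁ p₂ p₃ : Mom) {n : ℕ} (l : Mom) (π : Fin n → Mom) :
    restDenominator p₁ p₂ p₃ (n + 1) (Fin.cons l π : Fin (n + 1) → Mom) =
      (∏ k, cutFun p₁ p₂ (firstMom p₂ p₃ π) k l) * restDenominator p₁ p₂ p₃ n π := by
  rw [restDenominator, ← Fin.cons_snoc_eq_snoc_cons, Fin.prod_univ_succ, Fin.prod_univ_succ]
  simp only [Fin.cons_zero, Fin.cons_succ, Fin.castSucc_zero, ← Fin.succ_castSucc]
  rw [Fin.prod_univ_three]
  simp only [restDenominator, cutFun, firstMom, Matrix.cons_val]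
  ring

lemma ladderDenominator_eq (p₁ p₂ p₃ : Mom) {n : ℕ} (l : Fin n → Mom) :
    ladderDenominator p₁ p₂ p₃ n l = msq (firstMom p₂ p₃ l) * restDenominator p₁ p₂ p₃ n l := by
  rw [ladderDenominator, Fin.prod_univ_succ]
  simp only [chain, Fin.cons_zero, Fin.cons_succ, Fin.castSucc_zero, ← Fin.succ_castSucc]
  rw [restDenominator, firstMom, show ∀ u : Mom, msq (0 - u) = msq u from fun u => by
    simp [msq, mdot]]
  ring

/-! ### Every iterated residue has the same square -/

/-- If the square of the integrand is `C / (Q(ℓ₁) rest²)`, every step multiplies `C` by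
`-1 / (16 (p₁ + p₂)⁴)` and turns `Q` into the Källén function of the box, which again is the square
of `(p₁ + p₂)² ℓ²` on the polar sets of the external legs. -/
lemma sq_of_isIteratedResidue {p₁ p₂ p₃ : Mom} (hs : msq (p₁ + p₂) ≠ 0) (n : ℕ) :
    ∀ (V : Set (Fin (n + 1) → Mom)) (f : (Fin (n + 1) → Mom) → ℂ) (Q : Mom → ℂ) (C r : ℂ),
      C ≠ 0 → Continuous Q →
      (∀ l, msq (l - p₁) = 0 → msq (l + p₂) = 0 → Q l = (msq (p₁ + p₂) * msq l) ^ 2) →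
      (∀ l ∈ V, f l ^ 2 * Q (firstMom p₂ p₃ l) * restDenominator p₁ p₂ p₃ (n + 1) l ^ 2 = C) →
      IsIteratedResidue (ladderCut p₁ p₂ p₃) (n + 1) V f r →
      r ^ 2 * boxKallen p₁ p₂ (-(p₂ + p₃)) = C * (-1 / (16 * msq (p₁ + p₂) ^ 2)) ^ (n + 1) := by
  have hc : -1 / (16 * msq (p₁ + p₂) ^ 2) ≠ 0 :=
    div_ne_zero (by norm_num) (mul_ne_zero (by norm_num) (pow_ne_zero 2 hs))
  have hK : Continuous (boxKallen p₁ p₂) := by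
    unfold boxKallen kallen msq mdot
    fun_prop
  have step : ∀ {m : ℕ} {V : Set (Fin (m + 1) → Mom)} {f : (Fin (m + 1) → Mom) → ℂ} {Q : Mom → ℂ}
      {C : ℂ} {π : Fin m → Mom} {g : ℂ}, C ≠ 0 → Continuous Q →
      (∀ l, msq (l - p₁) = 0 → msq (l + p₂) = 0 → Q l = (msq (p₁ + p₂) * msq l) ^ 2) →
      (∀ l ∈ V, f l ^ 2 * Q (firstMom p₂ p₃ l) * restDenominator p₁ p₂ p₃ (m + 1) l ^ 2 = C) →
      IsMaximalResidue {l | (Fin.cons l π : Fin (m + 1) → Mom) ∈ V}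
        (fun l => f (Fin.cons l π : Fin (m + 1) → Mom)) (ladderCut p₁ p₂ p₃ m π) g →
      g ^ 2 * boxKallen p₁ p₂ (firstMom p₂ p₃ π) * restDenominator p₁ p₂ p₃ m π ^ 2 =
        C * (-1 / (16 * msq (p₁ + p₂) ^ 2)) := by
    intro m V f Q C π g hC hQ hQ' hV hg
    refine sq_of_isMaximalResidue hC hQ hQ' (fun l hl => ?_) hg
    have := hV _ hl
    rwa [firstMom_cons, restDenominator_cons] at this
  induction n with
  | zero =>
    rintro V f Q C r hC hQ hQ' hV ⟨W, g, -, -, hmax, hmem, rfl⟩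
    have := step hC hQ hQ' hV (hmax _ hmem)
    rwa [firstMom_zero, restDenominator_zero, one_pow, mul_one, ← pow_one (-1 / _)] at this
  | succ n ih =>
    rintro V f Q C r hC hQ hQ' hV ⟨W, g, -, -, hmax, hit⟩
    have := ih W g (boxKallen p₁ p₂) (C * (-1 / (16 * msq (p₁ + p₂) ^ 2))) r (mul_ne_zero hC hc) hK
      (fun l => boxKallen_of_cut) (fun π hπ => step hC hQ hQ' hV (hmax π hπ)) hit
    rw [this, pow_succ' _ (n + 1), mul_assoc]

/-! ### Both signs occur -/

/-- The branch of the square root of the Källén function that equals `(p₁ + p₂)² x²` on the polar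
sets of the external legs; meaningful on `rootDomain`. -/
def rootKallen (p₁ p₂ x : Mom) : ℂ :=
  msq (p₁ + p₂) * msq x *
    Complex.exp (Complex.log (boxKallen p₁ p₂ x / (msq (p₁ + p₂) * msq x) ^ 2) / 2)

/-- A domain on which `rootKallen` is holomorphic, avoiding the cut of the principal logarithm. -/
def rootDomain (p₁ p₂ : Mom) : Set Mom :=
  {x | msq (p₁ + p₂) * msq x ≠ 0 ∧
    boxKallen p₁ p₂ x / (msq (p₁ + p₂) * msq x) ^ 2 ∈ Complex.slitPlane}

lemma boxKallen_ne_zero_of_mem {p₁ p₂ x : Mom} (hx : x ∈ rootDomain p₁ p₂) :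
    boxKallen p₁ p₂ x ≠ 0 := by
  intro h
  have := hx.2
  rw [h, zero_div] at this
  exact Complex.zero_notMem_slitPlane this

lemma rootKallen_sq {p₁ p₂ x : Mom} (hx : x ∈ rootDomain p₁ p₂) :
    rootKallen p₁ p₂ x ^ 2 = boxKallen p₁ p₂ x := by
  rw [rootKallen, mul_pow _ (Complex.exp _), ← Complex.exp_nat_mul]
  rw [show ((2 : ℕ) : ℂ) * (Complex.log (boxKallen p₁ p₂ x / (msq (p₁ + p₂) * msq x) ^ 2) / 2) =
    Complex.log (boxKallen p₁ p₂ x / (msq (p₁ + p₂) * msq x) ^ 2) by push_cast; ring]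
  rw [Complex.exp_log (div_ne_zero (boxKallen_ne_zero_of_mem hx) (pow_ne_zero 2 hx.1))]
  exact mul_div_cancel₀ _ (pow_ne_zero 2 hx.1)

lemma rootKallen_ne_zero {p₁ p₂ x : Mom} (hx : x ∈ rootDomain p₁ p₂) : rootKallen p₁ p₂ x ≠ 0 :=
  fun h => boxKallen_ne_zero_of_mem hx (by rw [← rootKallen_sq hx, h]; ring)

lemma contDiff_boxKallen (p₁ p₂ : Mom) : ContDiff ℂ ⊤ (boxKallen p₁ p₂) := by
  unfold boxKallen kallen msq mdot
  fun_prop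

lemma analyticAt_rootKallen {p₁ p₂ x : Mom} (hx : x ∈ rootDomain p₁ p₂) :
    AnalyticAt ℂ (rootKallen p₁ p₂) x := by
  have h1 : AnalyticAt ℂ (fun x => msq (p₁ + p₂) * msq x) x :=
    analyticAt_const.mul contDiff_msq.contDiffAt.analyticAt
  have h2 : AnalyticAt ℂ (boxKallen p₁ p₂) x := (contDiff_boxKallen p₁ p₂).contDiffAt.analyticAt
  have h3 : AnalyticAt ℂ
      (fun x => boxKallen p₁ p₂ x / (msq (p₁ + p₂) * msq x) ^ 2) x :=
    h2.div (h1.pow 2) (pow_ne_zero 2 hx.1)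
  exact h1.mul ((h3.clog hx.2).div_const).cexp

lemma isOpen_rootDomain (p₁ p₂ : Mom) : IsOpen (rootDomain p₁ p₂) := by
  have h1 : Continuous fun x => msq (p₁ + p₂) * msq x := continuous_const.mul continuous_msq
  refine isOpen_iff_mem_nhds.2 fun x hx => ?_
  have h2 : ContinuousAt (fun x => boxKallen p₁ p₂ x / (msq (p₁ + p₂) * msq x) ^ 2) x :=
    (contDiff_boxKallen p₁ p₂).continuous.continuousAt.div (h1.pow 2).continuousAt
      (pow_ne_zero 2 hx.1)
  exact (h1.continuousAt.eventually_ne hx.1).and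
    (h2.eventually_mem (Complex.isOpen_slitPlane.mem_nhds hx.2))

lemma mem_rootDomain_of_cut {p₁ p₂ b : Mom} (hs : msq (p₁ + p₂) ≠ 0) (hb : msq b ≠ 0)
    (h₁ : msq (b - p₁) = 0) (h₂ : msq (b + p₂) = 0) :
    b ∈ rootDomain p₁ p₂ ∧ rootKallen p₁ p₂ b = msq (p₁ + p₂) * msq b := by
  have h0 := mul_ne_zero hs hb
  have h1 : boxKallen p₁ p₂ b / (msq (p₁ + p₂) * msq b) ^ 2 = 1 := by
    rw [boxKallen_of_cut h₁ h₂, div_self (pow_ne_zero 2 h0)]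
  refine ⟨⟨h0, ?_⟩, ?_⟩
  · rw [h1]
    exact Complex.one_mem_slitPlane
  · simp [rootKallen, h1]

/-- The later loop momenta for which the residue in the first one is taken: the remaining
propagators do not vanish and the next loop momentum is in general position. -/
def stageDomain (p₁ p₂ p₃ : Mom) (n : ℕ) : Set (Fin n → Mom) :=
  {π | restDenominator p₁ p₂ p₃ n π ≠ 0 ∧ firstMom p₂ p₃ π ∈ rootDomain p₁ p₂ ∧
    gram₃ p₁ p₂ (firstMom p₂ p₃ π) ≠ 0}

lemma contDiff_snoc (q : Mom) {n : ℕ} (i : Fin (n + 1)) :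
    ContDiff ℂ ⊤ fun π : Fin n → Mom => (Fin.snoc π q : Fin (n + 1) → Mom) i := by
  refine Fin.lastCases ?_ (fun j => ?_) i
  · simpa using contDiff_const
  · simpa using contDiff_apply ℂ Mom j

lemma contDiff_firstMom (p₂ p₃ : Mom) (n : ℕ) :
    ContDiff ℂ ⊤ fun π : Fin n → Mom => firstMom p₂ p₃ π := contDiff_snoc _ 0

lemma contDiff_restDenominator (p₁ p₂ p₃ : Mom) (n : ℕ) :
    ContDiff ℂ ⊤ (restDenominator p₁ p₂ p₃ n) := by
  refine ContDiff.mul (contDiff_prod fun i _ => ?_) (contDiff_prod fun i _ => ?_)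
  · exact (contDiff_msq.comp ((contDiff_apply ℂ Mom i).sub contDiff_const)).mul
      (contDiff_msq.comp ((contDiff_apply ℂ Mom i).add contDiff_const))
  · exact contDiff_msq.comp ((contDiff_snoc _ _).sub (contDiff_snoc _ _))

lemma isOpen_stageDomain (p₁ p₂ p₃ : Mom) (n : ℕ) : IsOpen (stageDomain p₁ p₂ p₃ n) := by
  have hf := (contDiff_firstMom p₂ p₃ n).continuous
  exact (isOpen_ne_fun (contDiff_restDenominator p₁ p₂ p₃ n).continuous continuous_const).inter
    (((isOpen_rootDomain p₁ p₂).preimage hf).inter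
      (isOpen_ne_fun ((continuous_gram₃ p₁ p₂).comp hf) continuous_const))

/-- An integrand that at fixed later loop momenta behaves, at the points in general position of the
cut curve, like `κ / ((p₁ + p₂)² ℓ² · D₀ D₁ D₂ · rest)`. -/
def HasLadderCut (p₁ p₂ p₃ : Mom) {n : ℕ} (V : Set (Fin (n + 1) → Mom))
    (f : (Fin (n + 1) → Mom) → ℂ) (κ : ℂ) : Prop :=
  ∀ π : Fin n → Mom, restDenominator p₁ p₂ p₃ n π ≠ 0 → ∀ b, msq b ≠ 0 → gram₃ p₁ p₂ b ≠ 0 →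
    (∀ k, ladderCut p₁ p₂ p₃ n π k b = 0) →
    ∃ N : Mom → ℂ, AnalyticAt ℂ N b ∧
      N b = κ / restDenominator p₁ p₂ p₃ n π / (msq (p₁ + p₂) * msq b) ∧
      ∀ᶠ l in 𝓝 b, (∀ k, ladderCut p₁ p₂ p₃ n π k l ≠ 0) →
        (Fin.cons l π : Fin (n + 1) → Mom) ∈ V ∧
          f (Fin.cons l π : Fin (n + 1) → Mom) * ∏ k, ladderCut p₁ p₂ p₃ n π k l = N l

lemma hasLadderCut_denominator {p₁ p₂ p₃ : Mom} (hs : msq (p₁ + p₂) ≠ 0) (n : ℕ) :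
    HasLadderCut p₁ p₂ p₃ {l : Fin (n + 1) → Mom | ladderDenominator p₁ p₂ p₃ (n + 1) l ≠ 0}
      (fun l => 1 / ladderDenominator p₁ p₂ p₃ (n + 1) l) (msq (p₁ + p₂)) := by
  intro π hπ b hb _ _
  refine ⟨fun l => 1 / (msq l * restDenominator p₁ p₂ p₃ n π), ?_, ?_, ?_⟩
  · exact analyticAt_const.div (contDiff_msq.contDiffAt.analyticAt.mul analyticAt_const)
      (mul_ne_zero hb hπ)
  · field_simp
  · filter_upwards [continuous_msq.continuousAt.eventually_ne hb] with l hl hk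
    have hprod : ∏ k, ladderCut p₁ p₂ p₃ n π k l ≠ 0 := Finset.prod_ne_zero_iff.2 fun k _ => hk k
    have hden : ladderDenominator p₁ p₂ p₃ (n + 1) (Fin.cons l π : Fin (n + 1) → Mom) =
        msq l * ((∏ k, ladderCut p₁ p₂ p₃ n π k l) * restDenominator p₁ p₂ p₃ n π) := by
      rw [ladderDenominator_eq, firstMom_cons, restDenominator_cons]
      rfl
    constructor
    · rw [hden]
      exact mul_ne_zero hl (mul_ne_zero hprod hπ)
    · simp only [hden]
      field_simp

lemma hasLadderCut_stage {p₁ p₂ p₃ : Mom} (hs : msq (p₁ + p₂) ≠ 0) (n : ℕ) (κ : ℂ) :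
    HasLadderCut p₁ p₂ p₃ (stageDomain p₁ p₂ p₃ (n + 1))
      (fun l => κ / restDenominator p₁ p₂ p₃ (n + 1) l / rootKallen p₁ p₂ (firstMom p₂ p₃ l))
      κ := by
  intro π hπ b hb hg hcut
  obtain ⟨hmem, hroot⟩ := mem_rootDomain_of_cut hs hb (hcut 0) (hcut 1)
  refine ⟨fun l => κ / restDenominator p₁ p₂ p₃ n π / rootKallen p₁ p₂ l, ?_, ?_, ?_⟩
  · exact analyticAt_const.div (analyticAt_rootKallen hmem) (rootKallen_ne_zero hmem)
  · simp only [hroot]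
  · filter_upwards [(isOpen_rootDomain p₁ p₂).mem_nhds hmem,
      (continuous_gram₃ p₁ p₂).continuousAt.eventually_ne hg] with l h1 h2 hk
    have hprod : ∏ k, ladderCut p₁ p₂ p₃ n π k l ≠ 0 := Finset.prod_ne_zero_iff.2 fun k _ => hk k
    have hden : restDenominator p₁ p₂ p₃ (n + 1) (Fin.cons l π : Fin (n + 1) → Mom) =
        (∏ k, ladderCut p₁ p₂ p₃ n π k l) * restDenominator p₁ p₂ p₃ n π :=
      restDenominator_cons p₁ p₂ p₃ l π
    have hr := rootKallen_ne_zero h1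
    refine ⟨⟨?_, ?_, ?_⟩, ?_⟩
    · rw [hden]
      exact mul_ne_zero hprod hπ
    · rwa [firstMom_cons]
    · rwa [firstMom_cons]
    · simp only [hden, firstMom_cons]
      field_simp

/-- Every stage multiplies the coefficient by `i / (4 (p₁ + p₂)²)`; at the last one the sign of the
root `ω` of the Källén function is free. -/
lemma isIteratedResidue_of_hasLadderCut {p₁ p₂ p₃ : Mom} (hp₁ : msq p₁ ≠ 0) (hp₂ : msq p₂ ≠ 0)
    (hs : msq (p₁ + p₂) ≠ 0) (hgram : gram₃ p₁ p₂ (-(p₂ + p₃)) ≠ 0) {ω : ℂ}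
    (hω : ω ^ 2 = boxKallen p₁ p₂ (-(p₂ + p₃))) (hω0 : ω ≠ 0) (n : ℕ) :
    ∀ (V : Set (Fin (n + 1) → Mom)) (f : (Fin (n + 1) → Mom) → ℂ) (κ : ℂ), κ ≠ 0 →
      HasLadderCut p₁ p₂ p₃ V f κ →
      IsIteratedResidue (ladderCut p₁ p₂ p₃) (n + 1) V f
        (κ * (Complex.I / (4 * msq (p₁ + p₂))) ^ (n + 1) / ω) := by
  have hc : Complex.I / (4 * msq (p₁ + p₂)) ≠ 0 :=
    div_ne_zero Complex.I_ne_zero (mul_ne_zero (by norm_num) hs)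
  induction n with
  | zero =>
    intro V f κ hκ hV
    refine ⟨Set.univ, fun _ => κ * (Complex.I / (4 * msq (p₁ + p₂))) ^ (0 + 1) / ω, isOpen_univ,
      fun _ _ => analyticAt_const, fun π _ => ?_, trivial, rfl⟩
    have hπ : restDenominator p₁ p₂ p₃ 0 π = 1 := restDenominator_zero p₁ p₂ p₃ π
    have hq := firstMom_zero p₂ p₃ π
    rw [zero_add, pow_one]
    refine isMaximalResidue_of_cut (x := firstMom p₂ p₃ π) hp₁ hp₂ hs (by rwa [hq]) (by rwa [hq])
      hω0 hκ fun b hb hg hcut => ?_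
    have := hV π (by rw [hπ]; exact one_ne_zero) b hb hg hcut
    rwa [hπ, div_one] at this
  | succ n ih =>
    intro V f κ hκ hV
    refine ⟨stageDomain p₁ p₂ p₃ (n + 1), fun l => κ * (Complex.I / (4 * msq (p₁ + p₂))) /
      restDenominator p₁ p₂ p₃ (n + 1) l / rootKallen p₁ p₂ (firstMom p₂ p₃ l),
      isOpen_stageDomain p₁ p₂ p₃ (n + 1), fun π hπ => ?_, fun π hπ => ?_, ?_⟩
    · refine (analyticAt_const.div
        (contDiff_restDenominator p₁ p₂ p₃ (n + 1)).contDiffAt.analyticAt hπ.1).div ?_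
        (rootKallen_ne_zero hπ.2.1)
      exact (analyticAt_rootKallen hπ.2.1).comp
        (contDiff_firstMom p₂ p₃ (n + 1)).contDiffAt.analyticAt
    · have := isMaximalResidue_of_cut (x := firstMom p₂ p₃ π) hp₁ hp₂ hs hπ.2.2
        (rootKallen_sq hπ.2.1) (rootKallen_ne_zero hπ.2.1) (div_ne_zero hκ hπ.1) (hV π hπ.1)
      rwa [div_mul_eq_mul_div] at this
    · have := ih (stageDomain p₁ p₂ p₃ (n + 1)) _ _ (mul_ne_zero hκ hc)
        (hasLadderCut_stage hs n (κ * (Complex.I / (4 * msq (p₁ + p₂)))))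
      rwa [mul_assoc κ, ← pow_succ' _ (n + 1)] at this

end Ladder

end

open Ladder in
theorem theorem4 (L : ℕ) (hL : 1 ≤ L) (p₁ p₂ p₃ p₄ : Ladder.Mom)
    (hcons : p₁ + p₂ + p₃ + p₄ = 0)
    (h₁ : Ladder.msq p₁ ≠ 0) (h₂ : Ladder.msq p₂ ≠ 0)
    (h₃ : Ladder.msq p₃ ≠ 0) (h₄ : Ladder.msq p₄ ≠ 0)
    (hgram : Ladder.gram₃ p₁ p₂ p₃ ≠ 0)
    (s t : ℂ) (hs : s = Ladder.msq (p₁ + p₂)) (ht : t = Ladder.msq (p₂ + p₃))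
    (hs0 : s ≠ 0) (ht0 : t ≠ 0)
    (w : ℂ)
    (hw : w ^ 2 = Ladder.kallen 1 (Ladder.msq p₁ * Ladder.msq p₃ / (s * t))
      (Ladder.msq p₂ * Ladder.msq p₄ / (s * t)))
    (hw0 : w ≠ 0) :
    {r : ℂ | Ladder.IsLeadingSingularity p₁ p₂ p₃ L r} =
      {(Complex.I / 4) ^ L * (1 / (s ^ L * t * w)),
        -((Complex.I / 4) ^ L * (1 / (s ^ L * t * w)))} := by
  obtain ⟨n, rfl⟩ : ∃ n, L = n + 1 := ⟨L - 1, by omega⟩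
  have hs' : msq (p₁ + p₂) ≠ 0 := hs ▸ hs0
  -- the Källén function of the last box, at the next momentum `-(p₂ + p₃)`
  have hbox : boxKallen p₁ p₂ (-(p₂ + p₃)) = (s * t * w) ^ 2 := by
    have e₃ : msq (-(p₂ + p₃) + p₂) = msq p₃ := by simp [msq, mdot]
    have e₄ : msq (-(p₂ + p₃) - p₁) = msq p₄ := by
      rw [show -(p₂ + p₃) - p₁ = p₄ by linear_combination -hcons]
    have et : msq (-(p₂ + p₃)) = t := by rw [ht]; simp [msq, mdot]; ring
    rw [boxKallen, e₃, e₄, et, ← hs, mul_pow, hw, kallen, kallen]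
    field_simp
    ring
  have hgram' : gram₃ p₁ p₂ (-(p₂ + p₃)) ≠ 0 := by
    have : gram₃ p₁ p₂ (-(p₂ + p₃)) = gram₃ p₁ p₂ p₃ := by
      rw [gram₃_expand, gram₃_expand]
      simp only [msq, mdot, Pi.neg_apply, Pi.add_apply]
      ring
    rwa [this]
  have hω0 : s * t * w ≠ 0 := mul_ne_zero (mul_ne_zero hs0 ht0) hw0
  have hexist : ∀ ω : ℂ, ω ^ 2 = (s * t * w) ^ 2 → ω ≠ 0 →
      IsLeadingSingularity p₁ p₂ p₃ (n + 1) (s * (Complex.I / (4 * s)) ^ (n + 1) / ω) := by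
    intro ω hω hne
    have := isIteratedResidue_of_hasLadderCut h₁ h₂ hs' hgram' (hω.trans hbox.symm) hne n _ _ _ hs'
      (hasLadderCut_denominator hs' n)
    rwa [← hs] at this
  have hval : (Complex.I / 4) ^ (n + 1) * (1 / (s ^ (n + 1) * t * w)) =
      s * (Complex.I / (4 * s)) ^ (n + 1) / (s * t * w) := by
    rw [div_pow, div_pow, mul_pow]
    field_simp
  rw [hval]
  ext r
  simp only [Set.mem_ofPred_eq, Set.mem_insert_iff, Set.mem_singleton_iff]
  constructor
  · intro hr
    have hsq := sq_of_isIteratedResidue (p₃ := p₃) hs' n _ _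
      (fun l => (msq (p₁ + p₂) * msq l) ^ 2) (msq (p₁ + p₂) ^ 2) r (pow_ne_zero 2 hs')
      ((continuous_const.mul continuous_msq).pow 2) (fun _ _ _ => rfl) (fun l hl => by
        rw [Set.mem_ofPred_eq] at hl
        rw [ladderDenominator_eq] at hl ⊢
        have := left_ne_zero_of_mul hl
        have := right_ne_zero_of_mul hl
        field_simp) hr
    rw [hbox, ← hs] at hsq
    refine sq_eq_sq_iff_eq_or_eq_neg.1 ?_
    have hI : (Complex.I / (4 * s)) ^ 2 = -1 / (16 * s ^ 2) := by
      rw [div_pow, Complex.I_sq]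
      ring
    rw [div_pow, eq_div_iff (pow_ne_zero 2 hω0), hsq, mul_pow, ← hI, ← pow_mul, ← pow_mul,
      mul_comm 2]
  · rintro (rfl | rfl)
    · exact hexist _ rfl hω0
    · rw [← div_neg]
      exact hexist _ (neg_sq _) (neg_ne_zero.2 hω0)
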